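/- Let $R$ be an associative ring with identity such that the pure-injective envelope of every flat left $R$-module is flat. Let $\mathbf K^{\mathcal F}$ be the class of flat left $R$-modules ordered by the pure submodule relation $\leq_{pp}$ (where $M\leq_{pp}N$ means that $L\otimes_R M\to L\otimes_R N$ is injective for every right $R$-module $L$); $\mathbf K^{\mathcal F}$-embeddings are the pure embeddings. Consider triples $(\bar b,A,N)$ with $N$ a flat left $R$-module, $A\subseteq N$ a subset and $\bar b$ a finite sequence from $N$. Call $(\bar b_1,A,N_1)$ and $(\bar b_2,A,N_2)$ atomically equivalent if there are a flat module $N$ and pure embeddings $f_\ell:N_\ell\to N$ ($\ell=1,2$) that agree on $A$, with $f_1(\bar b_1)=f_2(\bar b_2)$. The Galois-type $\mathbf{gtp}(\bar b/A;N)$ is the class of $(\bar b,A,N)$ under the transitive closure of atomic equivalence, and for $C\subseteq A$ put $\mathbf{gtp}(\bar b/A;N)\restriction_C=\mathbf{gtp}(\bar b/C;N)$. A $pp$-formula is an existentially quantified finite system of linear equations over $R$, and $pp(\bar b/A,N)$ is the set of $pp$-formulas $\phi(\bar x,\bar a)$ with $\bar a$ from $A$ and with $\bar x$ of the same length as $\bar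 b$ such that $N\models\phi(\bar b,\bar a)$. 1. Let $M,N_1,N_2$ be flat left $R$-modules with $M\leq_{pp}N_1$ and $M\leq_{pp}N_2$, and let $\bar b_1$ and $\bar b_2$ be finite tuples from $N_1$ and $N_2$ respectively. Then $$\mathbf{gtp}(\bar b_1/M;N_1)=\mathbf{gtp}(\bar b_2/M;N_2)\quad\text{if and only if}\quad pp(\bar b_1/M,N_1)=pp(\bar b_2/M,N_2).$$ 2. Consequently $\mathbf K^{\mathcal F}$ is $(<\aleph_0)$-tame: if $M$ is flat and $p\neq q$ are Galois-types over $M$ of single elements of flat modules $N$ with $M\leq_{pp}N$, then there is a finite $A\subseteq M$ with $p\restriction_A\neq q\restriction_A$. The same holds for Galois-types over $M$ of finite tuples. -/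

import Mathlib

open scoped TensorProduct Cardinal

universe u v w

section Tensor

variable {R : Type u} [Ring R]

/-- The relations `(l r) ⊗ m = l ⊗ (r m)`. Mathlib has the tensor product over commutative rings
only; a right `R`-module is a module over `Rᵐᵒᵖ`. -/
def balancedRelations (R : Type u) [Ring R] (L : Type v) [AddCommGroup L] [Module Rᵐᵒᵖ L]
    (M : Type w) [AddCommGroup M] [Module R M] : AddSubgroup (L ⊗[ℤ] M) :=
  AddSubgroup.closure
    {t | ∃ (l : L) (r : R) (m : M), t = (MulOpposite.op r • l) ⊗ₜ[ℤ] m - l ⊗ₜ[ℤ] (r • m)}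

/-- The tensor product `L ⊗_R M`, an abelian group, of a right module `L` and a left module `M` over
an arbitrary ring. -/
abbrev BalancedTensor (R : Type u) [Ring R] (L : Type v) [AddCommGroup L] [Module Rᵐᵒᵖ L]
    (M : Type w) [AddCommGroup M] [Module R M] : Type (max v w) :=
  (L ⊗[ℤ] M) ⧸ balancedRelations R L M

theorem balancedRelations_le_comap {L L' : Type*} [AddCommGroup L] [Module Rᵐᵒᵖ L]
    [AddCommGroup L'] [Module Rᵐᵒᵖ L'] {M M' : Type*} [AddCommGroup M] [Module R M]
    [AddCommGroup M'] [Module R M'] (f : L →ₗ[Rᵐᵒᵖ] L') (g : M →ₗ[R] M') :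
    balancedRelations R L M ≤ (balancedRelations R L' M').comap
      (TensorProduct.map f.toAddMonoidHom.toIntLinearMap
        g.toAddMonoidHom.toIntLinearMap).toAddMonoidHom := by
  refine (AddSubgroup.closure_le _).2 ?_
  rintro _ ⟨l, r, m, rfl⟩
  refine AddSubgroup.subset_closure ⟨f l, r, g m, ?_⟩
  simp

/-- The homomorphism `f ⊗ g : L ⊗_R M → L' ⊗_R M'`. -/
def BalancedTensor.map {L L' : Type*} [AddCommGroup L] [Module Rᵐᵒᵖ L]
    [AddCommGroup L'] [Module Rᵐᵒᵖ L'] {M M' : Type*} [AddCommGroup M] [Module R M]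
    [AddCommGroup M'] [Module R M'] (f : L →ₗ[Rᵐᵒᵖ] L') (g : M →ₗ[R] M') :
    BalancedTensor R L M →+ BalancedTensor R L' M' :=
  QuotientAddGroup.map _ _
    (TensorProduct.map f.toAddMonoidHom.toIntLinearMap
      g.toAddMonoidHom.toIntLinearMap).toAddMonoidHom
    (balancedRelations_le_comap f g)

end Tensor

section Modules

/-- The left `R`-module `F` is flat: `(-) ⊗ F` is an exact functor. -/
def IsFlatModule (R : Type u) [Ring R] (F : Type w) [AddCommGroup F] [Module R F] : Prop :=
  ∀ (L L' L'' : Type (max u w)) [AddCommGroup L] [Module Rᵐᵒᵖ L] [AddCommGroup L']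
    [Module Rᵐᵒᵖ L'] [AddCommGroup L''] [Module Rᵐᵒᵖ L'']
    (f : L →ₗ[Rᵐᵒᵖ] L') (g : L' →ₗ[Rᵐᵒᵖ] L''), Function.Exact f g →
    Function.Exact (BalancedTensor.map f (LinearMap.id : F →ₗ[R] F))
      (BalancedTensor.map g (LinearMap.id : F →ₗ[R] F))

variable {R : Type u} [Ring R]

/-- `f` is an isomorphism of `M` onto a pure submodule of `N`. -/
structure IsPureEmbedding {M N : Type w} [AddCommGroup M] [Module R M] [AddCommGroup N]
    [Module R N] (f : M →ₗ[R] N) : Prop where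
  injective : Function.Injective f
  tensor_injective : ∀ (L : Type (max u w)) [AddCommGroup L] [Module Rᵐᵒᵖ L],
    Function.Injective (BalancedTensor.map (LinearMap.id : L →ₗ[Rᵐᵒᵖ] L) f)

/-- `P` is pure-injective: homomorphisms into `P` extend along pure embeddings. -/
def IsPureInjective (R : Type u) [Ring R] (P : Type w) [AddCommGroup P] [Module R P] : Prop :=
  ∀ (A B : Type w) [AddCommGroup A] [Module R A] [AddCommGroup B] [Module R B]
    (f : A →ₗ[R] B) (g : A →ₗ[R] P), IsPureEmbedding f → ∃ h : B →ₗ[R] P, h ∘ₗ f = g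

/-- `i : M → E` is a pure-injective envelope of `M`. (As `i` is a pure embedding, every homomorphism
from `M` to a pure-injective module factors through `i`.) -/
structure IsPureInjectiveEnvelope {M E : Type w} [AddCommGroup M] [Module R M] [AddCommGroup E]
    [Module R E] (i : M →ₗ[R] E) : Prop where
  pureInjective : IsPureInjective R E
  pureEmbedding : IsPureEmbedding i
  bijective_of_comp_eq : ∀ f : E →ₗ[R] E, f ∘ₗ i = i → Function.Bijective f

end Modules

section GaloisTypes

/-- A triple `(b, A, N)` with `N` a flat module, `A` a subset of `N` (given by its inclusion map) and
`b` a finite sequence of elements of `N`. -/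
structure FlatTriple (R : Type u) [Ring R] (A : Type w) where
  model : Type w
  [addCommGroup : AddCommGroup model]
  [module : Module R model]
  flat : IsFlatModule R model
  incl : A ↪ model
  tuple : List model

attribute [instance] FlatTriple.addCommGroup FlatTriple.module

variable {R : Type u} [Ring R] {A : Type w}

/-- Atomic equivalence: there are pure embeddings over `A` of the two modules into one flat module `N`
which send the two sequences to the same sequence. -/
def FlatTriple.AtEquiv (T₁ T₂ : FlatTriple R A) : Prop :=
  ∃ (N : Type w) (_ : AddCommGroup N) (_ : Module R N) (f₁ : T₁.model →ₗ[R] N)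
    (f₂ : T₂.model →ₗ[R] N), IsFlatModule R N ∧ IsPureEmbedding f₁ ∧ IsPureEmbedding f₂ ∧
    (∀ a, f₁ (T₁.incl a) = f₂ (T₂.incl a)) ∧ T₁.tuple.map f₁ = T₂.tuple.map f₂

theorem IsPureEmbedding.id (M : Type w) [AddCommGroup M] [Module R M] :
    IsPureEmbedding (LinearMap.id : M →ₗ[R] M) := by
  refine ⟨Function.injective_id, fun L _ _ => ?_⟩
  have h : ∀ x, BalancedTensor.map (LinearMap.id : L →ₗ[Rᵐᵒᵖ] L) (LinearMap.id : M →ₗ[R] M) x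
      = x := by
    intro x
    obtain ⟨y, rfl⟩ := QuotientAddGroup.mk_surjective x
    refine congrArg QuotientAddGroup.mk ?_
    exact LinearMap.congr_fun (TensorProduct.map_id (R := ℤ) (M := L) (N := M)) y
  intro x y hxy
  rwa [h, h] at hxy

theorem FlatTriple.AtEquiv.refl (T : FlatTriple R A) : T.AtEquiv T :=
  ⟨T.model, inferInstance, inferInstance, LinearMap.id, LinearMap.id, T.flat, .id _, .id _,
    fun _ => rfl, rfl⟩

theorem FlatTriple.AtEquiv.symm {T₁ T₂ : FlatTriple R A} (h : T₁.AtEquiv T₂) : T₂.AtEquiv T₁ := by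
  obtain ⟨N, i, j, f₁, f₂, hN, h₁, h₂, hA, hb⟩ := h
  exact ⟨N, i, j, f₂, f₁, hN, h₂, h₁, fun a => (hA a).symm, hb.symm⟩

/-- The transitive closure of atomic equivalence. -/
instance FlatTriple.setoid (R : Type u) [Ring R] (A : Type w) : Setoid (FlatTriple R A) where
  r := Relation.TransGen FlatTriple.AtEquiv
  iseqv :=
    { refl := fun T => .single (.refl T)
      symm := fun h => by
        induction h with
        | single h => exact .single h.symm
        | tail _ h ih => exact .head h.symm ih
      trans := fun h h' => h.trans h' }

/-- Galois-types over `A` of finite sequences, in the class of flat modules with pure embeddings. -/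
def GaloisType (R : Type u) [Ring R] (A : Type w) : Type (max u (w + 1)) :=
  Quotient (FlatTriple.setoid R A)

/-- The Galois-type `gtp(b / A; N)`. -/
def gtp {N : Type w} [AddCommGroup N] [Module R N] (hN : IsFlatModule R N) (incl : A ↪ N)
    (b : List N) : GaloisType R A :=
  Quotient.mk _ { model := N, flat := hN, incl := incl, tuple := b }

/-- The triple `(b, C, N)` obtained from `(b, A, N)`, for `C ⊆ A`. -/
def FlatTriple.restrict (C : Set A) (T : FlatTriple R A) : FlatTriple R C where
  model := T.model
  flat := T.flat
  incl := (Function.Embedding.subtype _).trans T.incl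
  tuple := T.tuple

theorem FlatTriple.restrict_equiv (C : Set A) {T₁ T₂ : FlatTriple R A}
    (h : Relation.TransGen FlatTriple.AtEquiv T₁ T₂) :
    Relation.TransGen FlatTriple.AtEquiv (T₁.restrict C) (T₂.restrict C) := by
  have step : ∀ {S₁ S₂ : FlatTriple R A}, S₁.AtEquiv S₂ →
      (S₁.restrict C).AtEquiv (S₂.restrict C) := by
    rintro S₁ S₂ ⟨N, i, j, f₁, f₂, hN, h₁, h₂, hA, hb⟩
    exact ⟨N, i, j, f₁, f₂, hN, h₁, h₂, fun a => hA a, hb⟩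
  induction h with
  | single h => exact .single (step h)
  | tail _ h ih => exact ih.tail (step h)

/-- The restriction of a Galois-type to a subset `C` of its domain. -/
def GaloisType.restrict (C : Set A) : GaloisType R A → GaloisType R C :=
  Quotient.map (FlatTriple.restrict C) fun _ _ h => FlatTriple.restrict_equiv C h

/-- The Galois-types over the module `M` of finite tuples from pure flat extensions of `M`. -/
def finiteGaloisTypes (R : Type u) [Ring R] (M : Type w) [AddCommGroup M] [Module R M] :
    Set (GaloisType R M) :=
  {p | ∃ (N : Type w) (_ : AddCommGroup N) (_ : Module R N) (hN : IsFlatModule R N)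
    (i : M →ₗ[R] N) (hi : IsPureEmbedding i) (b : List N), p = gtp hN ⟨i, hi.injective⟩ b}

/-- The set `gS(M)` of Galois-types over the module `M` of single elements of pure flat extensions
of `M`. -/
def galoisTypes (R : Type u) [Ring R] (M : Type w) [AddCommGroup M] [Module R M] :
    Set (GaloisType R M) :=
  {p | ∃ (N : Type w) (_ : AddCommGroup N) (_ : Module R N) (hN : IsFlatModule R N)
    (i : M →ₗ[R] N) (hi : IsPureEmbedding i) (b : N), p = gtp hN ⟨i, hi.injective⟩ [b]}

/-- The class of flat modules with pure embeddings is `(< κ)`-tame. -/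
def FlatModulesTame (R : Type u) [Ring R] (κ : Cardinal.{w}) : Prop :=
  ∀ (M : Type w) [AddCommGroup M] [Module R M], IsFlatModule R M →
    ∀ p ∈ galoisTypes R M, ∀ q ∈ galoisTypes R M, p ≠ q →
      ∃ C : Set M, #C < κ ∧ p.restrict C ≠ q.restrict C

/-- The class of flat modules with pure embeddings is `(< κ)`-tame for Galois-types of finite
length. -/
def FlatModulesTameFinite (R : Type u) [Ring R] (κ : Cardinal.{w}) : Prop :=
  ∀ (M : Type w) [AddCommGroup M] [Module R M], IsFlatModule R M →
    ∀ p ∈ finiteGaloisTypes R M, ∀ q ∈ finiteGaloisTypes R M, p ≠ q →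
      ∃ C : Set M, #C < κ ∧ p.restrict C ≠ q.restrict C

end GaloisTypes

section PPTypes

/-- A positive primitive formula in the language of left `R`-modules with parameters from `B`: an
existentially quantified finite system of linear equations
`∃ z, ⋀ᵢ ∑ⱼ rᵢⱼ xⱼ + ∑ₖ sᵢₖ zₖ + ∑ₗ tᵢₗ bₗ = 0` in `arity` free variables `xⱼ`, with parameters
`bₗ ∈ B`. -/
structure PPFormula (R : Type u) (B : Type w) where
  arity : ℕ
  numBound : ℕ
  numParam : ℕ
  numEq : ℕ
  coeffFree : Fin numEq → Fin arity → R
  coeffBound : Fin numEq → Fin numBound → R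
  coeffParam : Fin numEq → Fin numParam → R
  param : Fin numParam → B

variable {R : Type u} [Ring R] {B : Type w}

/-- The formula holds in `N` of the tuple `x`; `incl` interprets the parameters in `N`. -/
def PPFormula.Realize (φ : PPFormula R B) {N : Type w} [AddCommGroup N] [Module R N]
    (incl : B → N) (x : Fin φ.arity → N) : Prop :=
  ∃ z : Fin φ.numBound → N, ∀ i, ∑ j, φ.coeffFree i j • x j + ∑ k, φ.coeffBound i k • z k +
    ∑ l, φ.coeffParam i l • incl (φ.param l) = 0

/-- The pp-type `pp(b / B, N)`, where `incl` is the inclusion of `B` in `N`: the pp-formulas over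
`B`, in as many free variables as `b` is long, that hold of `b` in `N`. -/
def ppType (R : Type u) [Ring R] {B N : Type w} [AddCommGroup N] [Module R N] (incl : B → N)
    (b : List N) : Set (PPFormula R B) :=
  {φ | ∃ h : φ.arity = b.length, φ.Realize incl fun j => b.get (Fin.cast h j)}

end PPTypes

/-! Pure embeddings preserve and reflect pp-formulas, so atomically equivalent triples have the same
pp-type, and hence Galois-types determine pp-types. For the converse, equal pp-types already give a
single atomic equivalence. Let `j₁ : N₁ → E₁` and `j₂ : N₂ → E₂` be pure-injective envelopes; both
`E₁` and `E₂` are flat by hypothesis. Equality of pp-types yields linear maps `g : N₁ → E₂` and `k :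
N₂ → E₁` that match the parameters and the tuples with their images under `j₂` and `j₁`. The maps
`(j₁, g)` and `(k, j₂)` into the flat module `E₁ × E₂` then agree on parameters and tuples, and each
is pure because one of its coordinates is. The maps `g` and `k` come from character duality. A
vanishing sum of tensors is witnessed by a finite linear system, so transfer of solvable systems is
an inclusion of kernels into tensor products (`SystemsTransfer.tensorSum_eq_zero`). Divisibility of
`ℝ/ℤ` turns this inclusion into a map to a character module, and every pure-injective module is a
retract of its double dual. Envelopes exist because the double dual of `M` is compact: a minimal
idempotent among its endomorphisms over `M` cuts out the envelope. Tameness follows because a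
pp-formula mentions only finitely many parameters. -/

/-! ### Universal property and functoriality of the balanced tensor product. -/

namespace BalancedTensor

variable {R : Type*} [Ring R] {L L' : Type*} [AddCommGroup L] [Module Rᵐᵒᵖ L]
  [AddCommGroup L'] [Module Rᵐᵒᵖ L'] {M M' : Type*} [AddCommGroup M] [Module R M]
  [AddCommGroup M'] [Module R M']

/-- The pure tensor `l ⊗ m`. -/
def tmul (R : Type*) [Ring R] {L : Type*} [AddCommGroup L] [Module Rᵐᵒᵖ L]
    {M : Type*} [AddCommGroup M] [Module R M] : L →+ M →+ BalancedTensor R L M :=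
  (AddMonoidHom.compHom (QuotientAddGroup.mk' (balancedRelations R L M))).comp
    { toFun := fun l => (TensorProduct.mk ℤ L M l).toAddMonoidHom
      map_zero' := by ext; simp
      map_add' := by intros; ext; simp }

theorem tmul_apply (l : L) (m : M) :
    tmul R l m = (QuotientAddGroup.mk (l ⊗ₜ[ℤ] m) : BalancedTensor R L M) := rfl

theorem op_smul_tmul (r : R) (l : L) (m : M) :
    tmul R (MulOpposite.op r • l) m = tmul R l (r • m) := by
  rw [← sub_eq_zero, tmul_apply, tmul_apply, ← QuotientAddGroup.mk_sub,
    QuotientAddGroup.eq_zero_iff]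
  exact AddSubgroup.subset_closure ⟨l, r, m, rfl⟩

@[simp]
theorem map_tmul (f : L →ₗ[Rᵐᵒᵖ] L') (g : M →ₗ[R] M') (l : L) (m : M) :
    map f g (tmul R l m) = tmul R (f l) (g m) := rfl

@[elab_as_elim]
theorem induction_on {p : BalancedTensor R L M → Prop} (t : BalancedTensor R L M)
    (zero : p 0) (tmul : ∀ l m, p (tmul R l m)) (add : ∀ x y, p x → p y → p (x + y)) : p t := by
  obtain ⟨y, rfl⟩ := QuotientAddGroup.mk_surjective t
  induction y using TensorProduct.induction_on with
  | zero => exact zero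
  | tmul l m => exact tmul l m
  | add x y hx hy => exact add _ _ hx hy

theorem hom_ext {X : Type*} [AddCommGroup X] {f g : BalancedTensor R L M →+ X}
    (h : ∀ l m, f (tmul R l m) = g (tmul R l m)) : f = g := by
  refine DFunLike.ext _ _ fun t => ?_
  induction t using BalancedTensor.induction_on with
  | zero => simp
  | tmul l m => exact h l m
  | add x y hx hy => rw [map_add, map_add, hx, hy]

/-- The homomorphism on `L ⊗_R M` induced by a balanced biadditive map. -/
def lift {X : Type*} [AddCommGroup X] (f : L →+ M →+ X)
    (hf : ∀ (r : R) l m, f (MulOpposite.op r • l) m = f l (r • m)) :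
    BalancedTensor R L M →+ X :=
  QuotientAddGroup.lift (balancedRelations R L M)
    (TensorProduct.liftAddHom f fun r l m => by rw [map_zsmul, map_zsmul]; rfl)
    ((AddSubgroup.closure_le _).2 (by
      rintro _ ⟨l, r, m, rfl⟩
      simp [AddMonoidHom.mem_ker, hf]))

theorem map_comp_apply {L'' M'' : Type*} [AddCommGroup L''] [Module Rᵐᵒᵖ L''] [AddCommGroup M'']
    [Module R M''] (f' : L' →ₗ[Rᵐᵒᵖ] L'') (f : L →ₗ[Rᵐᵒᵖ] L') (g' : M' →ₗ[R] M'')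
    (g : M →ₗ[R] M') (t : BalancedTensor R L M) :
    map (f' ∘ₗ f) (g' ∘ₗ g) t = map f' g' (map f g t) :=
  DFunLike.congr_fun (hom_ext (f := map (f' ∘ₗ f) (g' ∘ₗ g)) (g := (map f' g').comp (map f g))
    fun _ _ => rfl) t

theorem map_swap_apply (f : L →ₗ[Rᵐᵒᵖ] L') (g : M →ₗ[R] M') (t : BalancedTensor R L M) :
    map f .id (map .id g t) = map .id g (map f .id t) := by
  rw [← map_comp_apply, ← map_comp_apply]
  rfl

theorem map_add_right (f : L →ₗ[Rᵐᵒᵖ] L') (g g' : M →ₗ[R] M') :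
    map f (g + g') = map f g + map f g' :=
  hom_ext fun l m => by simp

@[simp]
theorem map_id_id (t : BalancedTensor R L M) : map .id .id t = t :=
  DFunLike.congr_fun (hom_ext (f := map (.id : L →ₗ[Rᵐᵒᵖ] L) (.id : M →ₗ[R] M))
    (g := .id _) fun _ _ => rfl) t

end BalancedTensor

open BalancedTensor

/-! ### Closure properties of pure embeddings and flat modules. -/

section Purity

variable {R : Type u} [Ring R]

theorem IsPureEmbedding.of_comp {M N P : Type w} [AddCommGroup M] [Module R M] [AddCommGroup N]
    [Module R N] [AddCommGroup P] [Module R P] {f : M →ₗ[R] N} {g : N →ₗ[R] P}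
    (h : IsPureEmbedding (g ∘ₗ f)) : IsPureEmbedding f := by
  refine ⟨Function.Injective.of_comp (f := g) h.injective, fun L _ _ =>
    Function.Injective.of_comp (f := map (.id : L →ₗ[Rᵐᵒᵖ] L) g) ?_⟩
  intro x y hxy
  refine h.tensor_injective L ?_
  have := map_comp_apply (.id : L →ₗ[Rᵐᵒᵖ] L) .id g f
  rw [LinearMap.comp_id] at this
  rw [this, this]
  exact hxy

theorem IsFlatModule.prod {M N : Type w} [AddCommGroup M] [Module R M] [AddCommGroup N]
    [Module R N] (hM : IsFlatModule R M) (hN : IsFlatModule R N) : IsFlatModule R (M × N) := by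
  intro L L' L'' _ _ _ _ _ _ f g hfg t
  constructor
  · intro ht
    obtain ⟨x, hx⟩ := (hM L L' L'' f g hfg (map .id (.fst R M N) t)).1 (by
      rw [map_swap_apply, ht, map_zero])
    obtain ⟨y, hy⟩ := (hN L L' L'' f g hfg (map .id (.snd R M N) t)).1 (by
      rw [map_swap_apply, ht, map_zero])
    refine ⟨map .id (.inl R M N) x + map .id (.inr R M N) y, ?_⟩
    rw [map_add, map_swap_apply, map_swap_apply, hx, hy, ← map_comp_apply, ← map_comp_apply,
      ← AddMonoidHom.add_apply, LinearMap.comp_id, ← map_add_right]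
    conv_rhs => rw [← map_id_id t]
    congr 2
    ext <;> simp
  · rintro ⟨x, rfl⟩
    have : g ∘ₗ f = 0 := by
      ext l
      exact (hfg (f l)).2 ⟨l, rfl⟩
    rw [← map_comp_apply, this]
    exact DFunLike.congr_fun (hom_ext (f := map (0 : L →ₗ[Rᵐᵒᵖ] L'') (.id ∘ₗ .id)) (g := 0)
      fun l m => by simp) x

end Purity

/-! ### Character duality between left and right modules. -/

section Characters

/-- The circle group `ℝ / ℤ` is an injective abelian group. -/
theorem AddCircle.exists_extension {A B : Type*} [AddCommGroup A] [AddCommGroup B]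
    (f : A →+ B) (hf : Function.Injective f) (g : A →+ AddCircle (1 : ℝ)) :
    ∃ h : B →+ AddCircle (1 : ℝ), h.comp f = g :=
  (Module.Baer.of_divisible _).extension_property_addMonoidHom f hf g

theorem AddCircle.exists_extension_of_ker_le {A B : Type*} [AddCommGroup A] [AddCommGroup B]
    (f : A →+ B) (g : A →+ AddCircle (1 : ℝ)) (hfg : f.ker ≤ g.ker) :
    ∃ h : B →+ AddCircle (1 : ℝ), ∀ a, h (f a) = g a := by
  obtain ⟨h, hh⟩ := AddCircle.exists_extension (QuotientAddGroup.kerLift f)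
    (QuotientAddGroup.kerLift_injective f) (QuotientAddGroup.lift f.ker g hfg)
  exact ⟨h, fun a => DFunLike.congr_fun hh (QuotientAddGroup.mk a)⟩

/-- Characters with values in `ℚ/ℤ` separate points, and `ℚ/ℤ` embeds in `ℝ/ℤ`. The real circle is
used because its compactness makes the character modules compact. -/
theorem AddCircle.exists_addMonoidHom_apply_ne_zero {A : Type*} [AddCommGroup A] {a : A}
    (ha : a ≠ 0) : ∃ c : A →+ AddCircle (1 : ℝ), c a ≠ 0 := by
  obtain ⟨c, hc⟩ := CharacterModule.exists_character_apply_ne_zero_of_ne_zero ha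
  let φ : AddCircle (1 : ℚ) →+ AddCircle (1 : ℝ) :=
    QuotientAddGroup.map _ _ (Rat.castHom ℝ).toAddMonoidHom (by
      rintro _ ⟨n, rfl⟩
      exact ⟨n, by simp⟩)
  have hφ : Function.Injective φ := by
    rw [injective_iff_map_eq_zero]
    intro x hx
    obtain ⟨q, rfl⟩ := QuotientAddGroup.mk_surjective x
    obtain ⟨n, hn⟩ := (QuotientAddGroup.eq_zero_iff _).1 hx
    refine (QuotientAddGroup.eq_zero_iff _).2 ⟨n, ?_⟩
    change n • (1 : ℝ) = (q : ℝ) at hn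
    simp only [zsmul_eq_mul, mul_one] at hn ⊢
    exact_mod_cast hn
  refine ⟨φ.comp (show A →+ AddCircle (1 : ℚ) from c), fun h => hc (hφ ?_)⟩
  rw [map_zero]
  exact h

/-- The character group of a left `R`-module, a right `R`-module. -/
def RightDual (M : Type*) [AddCommGroup M] : Type _ := M →+ AddCircle (1 : ℝ)

/-- The character group of a right `R`-module, a left `R`-module. -/
def LeftDual (D : Type*) [AddCommGroup D] : Type _ := D →+ AddCircle (1 : ℝ)

noncomputable instance (M : Type*) [AddCommGroup M] : AddCommGroup (RightDual M) :=
  inferInstanceAs (AddCommGroup (M →+ AddCircle (1 : ℝ)))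

noncomputable instance (D : Type*) [AddCommGroup D] : AddCommGroup (LeftDual D) :=
  inferInstanceAs (AddCommGroup (D →+ AddCircle (1 : ℝ)))

instance (M : Type*) [AddCommGroup M] : FunLike (RightDual M) M (AddCircle (1 : ℝ)) :=
  inferInstanceAs (FunLike (M →+ AddCircle (1 : ℝ)) _ _)

instance (M : Type*) [AddCommGroup M] :
    AddMonoidHomClass (RightDual M) M (AddCircle (1 : ℝ)) :=
  inferInstanceAs (AddMonoidHomClass (M →+ AddCircle (1 : ℝ)) _ _)

instance (D : Type*) [AddCommGroup D] : FunLike (LeftDual D) D (AddCircle (1 : ℝ)) :=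
  inferInstanceAs (FunLike (D →+ AddCircle (1 : ℝ)) _ _)

instance (D : Type*) [AddCommGroup D] :
    AddMonoidHomClass (LeftDual D) D (AddCircle (1 : ℝ)) :=
  inferInstanceAs (AddMonoidHomClass (D →+ AddCircle (1 : ℝ)) _ _)

variable {R : Type*} [Ring R]

@[simp]
theorem RightDual.zero_apply {M : Type*} [AddCommGroup M] (m : M) : (0 : RightDual M) m = 0 := rfl

@[ext]
theorem RightDual.ext {M : Type*} [AddCommGroup M] {f g : RightDual M} (h : ∀ m, f m = g m) :
    f = g := DFunLike.ext _ _ h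

@[ext]
theorem LeftDual.ext {D : Type*} [AddCommGroup D] {f g : LeftDual D} (h : ∀ d, f d = g d) :
    f = g := DFunLike.ext _ _ h

noncomputable instance (M : Type*) [AddCommGroup M] [Module R M] : Module Rᵐᵒᵖ (RightDual M) where
  smul r f := (AddMonoidHom.comp f (DistribSMul.toAddMonoidHom M r.unop) :)
  one_smul f := RightDual.ext fun m => congrArg f (one_smul R m)
  mul_smul r s f := RightDual.ext fun m => congrArg f (mul_smul s.unop r.unop m)
  smul_zero _ := rfl
  smul_add _ _ _ := rfl
  add_smul r s f := RightDual.ext fun m =>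
    (congrArg f (add_smul r.unop s.unop m)).trans (map_add f _ _)
  zero_smul f := RightDual.ext fun m => (congrArg f (zero_smul R m)).trans (map_zero f)

noncomputable instance (D : Type*) [AddCommGroup D] [Module Rᵐᵒᵖ D] : Module R (LeftDual D) where
  smul r f := (AddMonoidHom.comp f (DistribSMul.toAddMonoidHom D (MulOpposite.op r)) :)
  one_smul f := LeftDual.ext fun d => congrArg f (one_smul Rᵐᵒᵖ d)
  mul_smul r s f := LeftDual.ext fun d =>
    congrArg f (mul_smul (MulOpposite.op s) (MulOpposite.op r) d)
  smul_zero _ := rfl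
  smul_add _ _ _ := rfl
  add_smul r s f := LeftDual.ext fun d =>
    (congrArg f (add_smul (MulOpposite.op r) (MulOpposite.op s) d)).trans (map_add f _ _)
  zero_smul f := LeftDual.ext fun d => (congrArg f (zero_smul Rᵐᵒᵖ d)).trans (map_zero f)

@[simp]
theorem RightDual.smul_apply {M : Type*} [AddCommGroup M] [Module R M] (r : Rᵐᵒᵖ)
    (f : RightDual M) (m : M) : (r • f) m = f (r.unop • m) := rfl

@[simp]
theorem LeftDual.smul_apply {D : Type*} [AddCommGroup D] [Module Rᵐᵒᵖ D] (r : R)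
    (f : LeftDual D) (d : D) : (r • f) d = f (MulOpposite.op r • d) := rfl

/-- The right dual `l ↦ χ (l ⊗ -)` of a character `χ` of `L ⊗_R M`. -/
noncomputable def RightDual.ofCharacter {L M : Type*} [AddCommGroup L] [Module Rᵐᵒᵖ L]
    [AddCommGroup M] [Module R M] (c : BalancedTensor R L M →+ AddCircle (1 : ℝ)) :
    L →+ RightDual M where
  toFun l := (c.comp (tmul R l) :)
  map_zero' := RightDual.ext fun m => by
    change c (tmul R 0 m) = 0
    simp
  map_add' l l' := RightDual.ext fun m => by
    change c (tmul R (l + l') m) = c (tmul R l m) + c (tmul R l' m)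
    simp

theorem RightDual.ofCharacter_apply {L M : Type*} [AddCommGroup L] [Module Rᵐᵒᵖ L]
    [AddCommGroup M] [Module R M] (c : BalancedTensor R L M →+ AddCircle (1 : ℝ)) (l : L) (m : M) :
    RightDual.ofCharacter c l m = c (tmul R l m) := rfl

/-- The map `M → Hom(L, ℝ/ℤ)` given by a character of `L ⊗_R M`. -/
noncomputable def LeftDual.ofCharacter {L M : Type*} [AddCommGroup L] [Module Rᵐᵒᵖ L]
    [AddCommGroup M] [Module R M] (c : BalancedTensor R L M →+ AddCircle (1 : ℝ)) :
    M →ₗ[R] LeftDual L where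
  toFun m := (c.comp ((tmul R).flip m) :)
  map_add' m m' := LeftDual.ext fun l => by
    change c (tmul R l (m + m')) = c (tmul R l m) + c (tmul R l m')
    simp
  map_smul' r m := LeftDual.ext fun l => by
    change c (tmul R l (r • m)) = c (tmul R (MulOpposite.op r • l) m)
    rw [op_smul_tmul]

/-- The character `l ⊗ m ↦ g m l` of `L ⊗_R M`. -/
noncomputable def LeftDual.toCharacter {L M : Type*} [AddCommGroup L] [Module Rᵐᵒᵖ L]
    [AddCommGroup M] [Module R M] (g : M →ₗ[R] LeftDual L) :
    BalancedTensor R L M →+ AddCircle (1 : ℝ) :=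
  BalancedTensor.lift (AddMonoidHom.flip
    { toFun := fun m => (show L →+ AddCircle (1 : ℝ) from g m)
      map_zero' := g.map_zero
      map_add' := g.map_add }) fun r l m => by
    change g m (MulOpposite.op r • l) = g (r • m) l
    simp

/-- The evaluation map of a module into its double dual. -/
noncomputable def doubleDualEval (R : Type*) [Ring R] (M : Type*) [AddCommGroup M] [Module R M] :
    M →ₗ[R] LeftDual (RightDual M) where
  toFun m :=
    { toFun := fun d : RightDual M => d m
      map_zero' := rfl
      map_add' := fun _ _ => rfl }
  map_add' m m' := LeftDual.ext fun d => map_add d m m'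
  map_smul' _ _ := rfl

/-- Every character `c` of `L ⊗ M` extends to `L ⊗ M**` by `l ⊗ p ↦ p (c (l ⊗ -))`. Since characters
separate points, nothing nonzero in `L ⊗ M` can die. -/
theorem doubleDualEval_isPureEmbedding {R : Type u} [Ring R] (M : Type w) [AddCommGroup M]
    [Module R M] : IsPureEmbedding (doubleDualEval R M) := by
  constructor
  · rw [injective_iff_map_eq_zero]
    intro m hm
    by_contra hne
    obtain ⟨c, hc⟩ := AddCircle.exists_addMonoidHom_apply_ne_zero hne
    exact hc (DFunLike.congr_fun hm (show RightDual M from c))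
  · intro L _ _
    rw [injective_iff_map_eq_zero]
    intro x hx
    by_contra hne
    obtain ⟨c, hc⟩ := AddCircle.exists_addMonoidHom_apply_ne_zero hne
    let ψ : BalancedTensor R L (LeftDual (RightDual M)) →+ AddCircle (1 : ℝ) :=
      BalancedTensor.lift
        (AddMonoidHom.flip
          { toFun := fun p : LeftDual (RightDual M) =>
              (show RightDual M →+ AddCircle (1 : ℝ) from p).comp (RightDual.ofCharacter c)
            map_zero' := rfl
            map_add' := fun _ _ => rfl })
        fun r l p => by
          change p (RightDual.ofCharacter c (MulOpposite.op r • l)) =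
            p (MulOpposite.op r • RightDual.ofCharacter c l)
          congr 1
          ext m
          simp [RightDual.ofCharacter_apply, op_smul_tmul]
    have h : ψ.comp (map .id (doubleDualEval R M)) = c := hom_ext fun l m => rfl
    apply hc
    rw [← h, AddMonoidHom.comp_apply, hx, map_zero]

/-- By adjunction, a map `A → D*` is a character of `D ⊗ A`. Purity makes `D ⊗ A → D ⊗ B` injective,
so the character extends. -/
theorem LeftDual.isPureInjective {R : Type u} [Ring R] {D : Type (max u w)} [AddCommGroup D]
    [Module Rᵐᵒᵖ D] : IsPureInjective R (LeftDual D) := by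
  intro A B _ _ _ _ f g hf
  obtain ⟨c, hc⟩ := AddCircle.exists_extension _ (hf.tensor_injective D) (toCharacter g)
  refine ⟨ofCharacter c, LinearMap.ext fun a => LeftDual.ext fun d => ?_⟩
  exact DFunLike.congr_fun hc (tmul R d a)

end Characters

/-! ### Minimal idempotents and the existence of pure-injective envelopes. -/

/-- A compact semigroup of self-maps, in the topology of pointwise convergence, contains an
idempotent generating a minimal left ideal. -/
theorem exists_minimal_idempotent_selfMap {X : Type*} [TopologicalSpace X] [CompactSpace X]
    [T2Space X] (S : Set (X → X)) (hS : IsClosed S) (hne : S.Nonempty)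
    (hcomp : ∀ f ∈ S, ∀ g ∈ S, f ∘ g ∈ S) :
    ∃ e ∈ S, e ∘ e = e ∧ ∀ s ∈ S, ∃ t ∈ S, t ∘ s ∘ e = e := by
  -- Only precomposition is continuous for pointwise convergence; this one-sided continuity suffices
  -- for the Ellis–Numakura lemma.
  have hcont : ∀ g : X → X, Continuous fun f : X → X => f ∘ g := fun g =>
    continuous_pi fun x => continuous_apply (g x)
  let F : Set (Set (X → X)) :=
    {I | IsClosed I ∧ I.Nonempty ∧ I ⊆ S ∧ ∀ f ∈ S, ∀ g ∈ I, f ∘ g ∈ I}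
  -- Compactness keeps intersections of chains nonempty, so there is a minimal closed left ideal
  -- `I`.
  obtain ⟨I, -, hI⟩ := zorn_superset_nonempty F (by
    intro c hc hchain hcne
    have : Nonempty c := hcne.to_subtype
    refine ⟨⋂₀ c, ⟨isClosed_sInter fun I hI => (hc hI).1, ?_, ?_, ?_⟩, fun I hI =>
      Set.sInter_subset_of_mem hI⟩
    · exact IsCompact.nonempty_sInter_of_directed_nonempty_isCompact_isClosed
        (IsChain.directedOn hchain.symm) (fun I hI => (hc hI).2.1)
        (fun I hI => (hc hI).1.isCompact) (fun I hI => (hc hI).1)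
    · obtain ⟨I, hI⟩ := hcne
      exact (Set.sInter_subset_of_mem hI).trans (hc hI).2.2.1
    · intro f hf g hg I hI
      exact (hc hI).2.2.2 f hf g (hg I hI)) S ⟨hS, hne, subset_rfl, hcomp⟩
  obtain ⟨hIcl, hIne, hIS, hIl⟩ := hI.prop
  obtain ⟨e, he, hee⟩ : ∃ e ∈ I, e ∘ e = e := by
    let : Semigroup (X → X) := { mul := fun f g => f ∘ g, mul_assoc := fun _ _ _ => rfl }
    exact exists_idempotent_in_compact_subsemigroup hcont I hIne hIcl.isCompact
      fun f hf g hg => hIl f (hIS hf) g hg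
  refine ⟨e, hIS he, hee, fun s hs => ?_⟩
  -- The closed left ideal `S ∘ s ∘ e` lies in `I`, so by minimality it contains `e`.
  have hmem : (fun f : X → X => f ∘ (s ∘ e)) '' S ∈ F := by
    refine ⟨(hS.isCompact.image (hcont _)).isClosed, hne.image _, ?_, ?_⟩
    · rintro _ ⟨f, hf, rfl⟩
      exact hcomp f hf _ (hcomp s hs e (hIS he))
    · rintro f hf _ ⟨g, hg, rfl⟩
      exact ⟨f ∘ g, hcomp f hf g hg, rfl⟩
  have hle : (fun f : X → X => f ∘ (s ∘ e)) '' S ⊆ I := by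
    rintro _ ⟨f, hf, rfl⟩
    exact hIl f hf _ (hIl s hs e he)
  obtain ⟨t, ht, hte⟩ := hI.le_of_le hmem hle he
  exact ⟨t, ht, hte⟩

section Topology

variable {D : Type*} [AddCommGroup D]

/-- The topology of pointwise convergence on a character group. -/
instance : TopologicalSpace (LeftDual D) :=
  .induced (fun p : LeftDual D => (p : D → AddCircle (1 : ℝ))) inferInstance

theorem LeftDual.isClosedEmbedding_coe :
    Topology.IsClosedEmbedding (fun p : LeftDual D => (p : D → AddCircle (1 : ℝ))) :=
  ⟨⟨⟨rfl⟩, DFunLike.coe_injective⟩, AddMonoidHom.isClosed_range_coe D (AddCircle (1 : ℝ))⟩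

instance : CompactSpace (LeftDual D) :=
  LeftDual.isClosedEmbedding_coe.compactSpace

instance : T2Space (LeftDual D) :=
  LeftDual.isClosedEmbedding_coe.isEmbedding.t2Space

theorem LeftDual.continuous_apply (d : D) : Continuous fun p : LeftDual D => p d :=
  (_root_.continuous_apply d).comp LeftDual.isClosedEmbedding_coe.continuous

theorem LeftDual.continuous_of_apply {X : Type*} [TopologicalSpace X] {f : X → LeftDual D}
    (h : ∀ d, Continuous fun x => f x d) : Continuous f :=
  LeftDual.isClosedEmbedding_coe.isEmbedding.continuous_iff.2 (continuous_pi h)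

instance : ContinuousAdd (LeftDual D) :=
  ⟨LeftDual.continuous_of_apply fun d =>
    ((LeftDual.continuous_apply d).comp continuous_fst).add
      ((LeftDual.continuous_apply d).comp continuous_snd)⟩

instance {R : Type*} [Ring R] [Module Rᵐᵒᵖ D] : ContinuousConstSMul R (LeftDual D) :=
  ⟨fun r => LeftDual.continuous_of_apply fun d =>
    LeftDual.continuous_apply (MulOpposite.op r • d)⟩

end Topology

/-- Every module has a pure-injective envelope. -/
theorem exists_isPureInjectiveEnvelope {R : Type u} [Ring R] (M : Type (max u v)) [AddCommGroup M]
    [Module R M] : ∃ (E : Type (max u v)) (_ : AddCommGroup E) (_ : Module R E) (i : M →ₗ[R] E),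
      IsPureInjectiveEnvelope i := by
  let P := LeftDual (RightDual M)
  let j : M →ₗ[R] P := doubleDualEval R M
  have hj : IsPureEmbedding j := doubleDualEval_isPureEmbedding M
  let S : Set (P → P) := Set.range (fun f : P →ₗ[R] P => (f : P → P)) ∩ {f | ∀ m, f (j m) = j m}
  -- The endomorphisms need not be continuous: being linear and fixing each `j m` are closed
  -- conditions on a self-map of the Hausdorff topological module `P`.
  have hS : IsClosed S := by
    refine (LinearMap.isClosed_range_coe P P (RingHom.id R)).inter ?_
    simp only [Set.ofPred_forall]
    exact isClosed_iInter fun m => isClosed_eq (continuous_apply _) continuous_const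
  obtain ⟨_, ⟨⟨e, rfl⟩, hej⟩, hee, hmin⟩ := exists_minimal_idempotent_selfMap S hS
    ⟨id, ⟨.id, rfl⟩, fun m => rfl⟩ (by
      rintro _ ⟨⟨f, rfl⟩, hf⟩ _ ⟨⟨g, rfl⟩, hg⟩
      refine ⟨⟨f ∘ₗ g, rfl⟩, fun m => ?_⟩
      change f (g (j m)) = j m
      exact (congrArg f (hg m)).trans (hf m))
  have hee' : ∀ p, e (e p) = e p := congrFun hee
  have heE : ∀ x : e.range, e x = x := by
    rintro ⟨_, p, rfl⟩
    exact hee' p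
  have hej' : ∀ m, e (j m) = j m := hej
  let i : M →ₗ[R] e.range := j.codRestrict _ fun m => ⟨j m, hej m⟩
  have left_inv : ∀ f : e.range →ₗ[R] e.range, f ∘ₗ i = i →
      ∃ g : e.range →ₗ[R] e.range, g ∘ₗ i = i ∧ ∀ x, g (f x) = x := by
    intro f hf
    have hfi : ∀ m, f (i m) = i m := LinearMap.congr_fun hf
    -- Extend `f` to an endomorphism of `P` through the projection `e`; minimality of `e` supplies
    -- `t` undoing it on the range of `e`.
    obtain ⟨_, ⟨⟨t, rfl⟩, htj⟩, hte⟩ := hmin (e.range.subtype ∘ₗ f ∘ₗ e.rangeRestrict) ⟨⟨_, rfl⟩,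
      fun m => by
        have : e.rangeRestrict (j m) = i m := Subtype.ext (hej' m)
        change (f (e.rangeRestrict (j m)) : P) = j m
        rw [this, hfi]
        rfl⟩
    refine ⟨e.rangeRestrict ∘ₗ t ∘ₗ e.range.subtype, LinearMap.ext fun m => Subtype.ext ?_,
      fun x => Subtype.ext ?_⟩
    · change e (t (j m)) = j m
      exact (congrArg e (htj m)).trans (hej' m)
    · change e (t (f x)) = x
      have h : t (f (e.rangeRestrict (e x))) = e x := congrFun hte x
      have h' : e.rangeRestrict (e x) = x := Subtype.ext ((hee' x).trans (heE x))
      rw [h', heE] at h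
      rw [h, heE]
  refine ⟨e.range, inferInstance, inferInstance, i, ?_, ?_, ?_⟩
  · intro A B _ _ _ _ f g hf
    -- A retract of a pure-injective module is pure-injective: extend into `P`, then project by `e`.
    obtain ⟨h, hh⟩ := LeftDual.isPureInjective.{u, max u v} A B f (e.range.subtype ∘ₗ g) hf
    refine ⟨e.rangeRestrict ∘ₗ h, LinearMap.ext fun a => Subtype.ext ?_⟩
    change e (h (f a)) = g a
    rw [show h (f a) = g a from LinearMap.congr_fun hh a, heE]
  · exact IsPureEmbedding.of_comp (g := e.range.subtype) hj
  · intro f hf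
    obtain ⟨g, hg, hgf⟩ := left_inv f hf
    obtain ⟨k, -, hkg⟩ := left_inv g hg
    -- The left inverse `g` of `f` has its own left inverse `k`, so `f (g x) = k (g (f (g x))) = k
    -- (g x) = x`.
    refine ⟨Function.LeftInverse.injective hgf, fun x => ⟨g x, ?_⟩⟩
    rw [← hkg (f (g x)), hgf, hkg]

/-! ### Finite linear witnesses for the vanishing of a sum of tensors. -/

section TensorSum

variable {R : Type*} [Ring R] {L : Type*} [AddCommGroup L] [Module Rᵐᵒᵖ L]

/-- The homomorphism `f ↦ ∑ x, f x ⊗ z x`. -/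
noncomputable def tensorSum (R : Type*) [Ring R] (L : Type*) [AddCommGroup L] [Module Rᵐᵒᵖ L]
    {ι N : Type*} [AddCommGroup N] [Module R N] (z : ι → N) :
    (ι →₀ L) →+ BalancedTensor R L N :=
  Finsupp.liftAddHom fun x => (tmul R).flip (z x)

@[simp]
theorem tensorSum_single {ι N : Type*} [AddCommGroup N] [Module R N] (z : ι → N) (x : ι) (l : L) :
    tensorSum R L z (Finsupp.single x l) = tmul R l (z x) := by
  simp [tensorSum]

theorem tensorSum_mapDomain {ι κ N : Type*} [AddCommGroup N] [Module R N] (z : κ → N) (y : ι → κ)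
    (f : ι →₀ L) : tensorSum R L z (f.mapDomain y) = tensorSum R L (z ∘ y) f := by
  induction f using Finsupp.induction_linear with
  | zero => simp
  | add f g hf hg => rw [Finsupp.mapDomain_add, map_add, map_add, hf, hg]
  | single x l => simp

theorem tensorSum_congr {ι N : Type*} [AddCommGroup N] [Module R N] {z z' : ι → N} {f : ι →₀ L}
    (h : ∀ x ∈ f.support, z x = z' x) : tensorSum R L z f = tensorSum R L z' f := by
  simp only [tensorSum, Finsupp.liftAddHom_apply]
  exact Finsupp.sum_congr fun x hx => by rw [h x hx]

/-- The family `l r` indexed as the coefficients `r` of `κ`. -/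
noncomputable def opSMulFinsupp {ι : Type*} (l : L) : (ι →₀ R) →+ (ι →₀ L) :=
  Finsupp.mapRange.addMonoidHom
    { toFun := fun r => MulOpposite.op r • l
      map_zero' := by simp
      map_add' := fun r s => by rw [MulOpposite.op_add, add_smul] }

@[simp]
theorem opSMulFinsupp_single {ι : Type*} (l : L) (x : ι) (r : R) :
    opSMulFinsupp l (Finsupp.single x r) = Finsupp.single x (MulOpposite.op r • l) := by
  simp [opSMulFinsupp]

theorem tensorSum_opSMulFinsupp {ι N : Type*} [AddCommGroup N] [Module R N] (z : ι → N) (l : L)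
    (κ : ι →₀ R) :
    tensorSum R L z (opSMulFinsupp l κ) = tmul R l (Finsupp.linearCombination R z κ) := by
  induction κ using Finsupp.induction_linear with
  | zero => simp
  | add f g hf hg => simp [hf, hg]
  | single x r => simp [op_smul_tmul]

variable (R L) in
/-- The relations which hold in `L ⊗_R N` between the pure tensors. -/
noncomputable def tensorSumRelations (N : Type*) [AddCommGroup N] [Module R N] : AddSubgroup (N →₀ L) :=
  AddSubgroup.closure
    {t | ∃ (l : L) (κ : N →₀ R), Finsupp.linearCombination R id κ = 0 ∧ t = opSMulFinsupp l κ}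

/-- Modulo these relations, `l ⊗ n ↦ [single n l]` is well defined: additivity in `n` and
balancedness are themselves linear relations between elements of `N`. Composed with `tensorSum` it
is the quotient map. -/
theorem mem_tensorSumRelations {N : Type*} [AddCommGroup N] [Module R N] {f : N →₀ L}
    (hf : tensorSum R L (id : N → N) f = 0) : f ∈ tensorSumRelations R L N := by
  let H := tensorSumRelations R L N
  have hmem : ∀ (l : L) (κ : N →₀ R), Finsupp.linearCombination R id κ = 0 →
      (QuotientAddGroup.mk (opSMulFinsupp l κ) : (N →₀ L) ⧸ H) = 0 := fun l κ h =>
    (QuotientAddGroup.eq_zero_iff _).2 (AddSubgroup.subset_closure ⟨l, κ, h, rfl⟩)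
  let Φ : BalancedTensor R L N →+ (N →₀ L) ⧸ H := BalancedTensor.lift
    (AddMonoidHom.flip
      { toFun := fun n => (QuotientAddGroup.mk' H).comp (Finsupp.singleAddHom n)
        map_zero' := by
          ext l
          simpa using hmem l (Finsupp.single 0 1) (by simp)
        map_add' := fun n n' => by
          ext l
          have := hmem l (Finsupp.single (n + n') 1 - (Finsupp.single n 1 + Finsupp.single n' 1))
            (by simp)
          simp only [map_sub, map_add, opSMulFinsupp_single, MulOpposite.op_one, one_smul] at this
          rw [QuotientAddGroup.mk_sub, sub_eq_zero] at this
          exact this }) fun r l n => by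
    have := hmem l (Finsupp.single n r - Finsupp.single (r • n) 1) (by simp)
    simp only [map_sub, opSMulFinsupp_single, MulOpposite.op_one, one_smul] at this
    rw [QuotientAddGroup.mk_sub, sub_eq_zero] at this
    exact this
  have hΦ : Φ.comp (tensorSum R L id) = QuotientAddGroup.mk' H := by
    refine Finsupp.addHom_ext fun n l => ?_
    rw [AddMonoidHom.comp_apply, tensorSum_single]
    rfl
  rw [← QuotientAddGroup.eq_zero_iff]
  change QuotientAddGroup.mk' H f = 0
  rw [← hΦ, AddMonoidHom.comp_apply, hf, map_zero]

/-- If `∑ x, f x ⊗ x` vanishes in `L ⊗ N`, then it does so because of finitely many linear relations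
between elements of `N`. -/
theorem exists_finset_relations_of_tensorSum_eq_zero {N : Type*} (N' : Type*) [AddCommGroup N]
    [Module R N] [AddCommGroup N'] [Module R N'] {f : N →₀ L}
    (hf : tensorSum R L (id : N → N) f = 0) :
    ∃ T : Finset (N →₀ R), (∀ κ ∈ T, Finsupp.linearCombination R id κ = 0) ∧
      ∀ z : N → N', (∀ κ ∈ T, Finsupp.linearCombination R z κ = 0) → tensorSum R L z f = 0 := by
  classical
  have hmem := mem_tensorSumRelations hf
  clear hf
  induction hmem using AddSubgroup.closure_induction with
  | mem t ht =>
    obtain ⟨l, κ, hκ, rfl⟩ := ht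
    refine ⟨{κ}, by simpa using hκ, fun z hz => ?_⟩
    rw [tensorSum_opSMulFinsupp, hz κ (Finset.mem_singleton_self κ), map_zero]
  | zero => exact ⟨∅, by simp, fun z _ => map_zero _⟩
  | add x y _ _ hx hy =>
    obtain ⟨T, hT, hT'⟩ := hx
    obtain ⟨T₂, hT₂, hT₂'⟩ := hy
    refine ⟨T ∪ T₂, fun κ hκ => (Finset.mem_union.1 hκ).elim (hT κ) (hT₂ κ), fun z hz => ?_⟩
    rw [map_add, hT' z fun κ hκ => hz κ (Finset.mem_union_left _ hκ),
      hT₂' z fun κ hκ => hz κ (Finset.mem_union_right _ hκ), add_zero]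
  | neg x _ hx =>
    obtain ⟨T, hT, hT'⟩ := hx
    exact ⟨T, hT, fun z hz => by rw [map_neg, hT' z hz, neg_zero]⟩

end TensorSum

/-! ### From transfer of linear systems to linear maps. -/

section Transfer

variable {R : Type*} [Ring R] {ι N₁ N₂ : Type*} [AddCommGroup N₁] [Module R N₁]
  [AddCommGroup N₂] [Module R N₂]

/-- Every finite linear system with parameters from the family `n₁` that is solvable in `N₁` is
solvable in `N₂` with the parameters replaced by those from the family `n₂`. -/
def SystemsTransfer (R : Type*) [Ring R] {ι N₁ N₂ : Type*} [AddCommGroup N₁] [Module R N₁]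
    [AddCommGroup N₂] [Module R N₂] (n₁ : ι → N₁) (n₂ : ι → N₂) : Prop :=
  ∀ (s p q : ℕ) (x : Fin s → ι) (S : Fin q → Fin s → R) (U : Fin q → Fin p → R),
    (∃ z : Fin p → N₁, ∀ i, ∑ j, S i j • n₁ (x j) + ∑ k, U i k • z k = 0) →
      ∃ z : Fin p → N₂, ∀ i, ∑ j, S i j • n₂ (x j) + ∑ k, U i k • z k = 0

theorem SystemsTransfer.of_fintype {n₁ : ι → N₁} {n₂ : ι → N₂} (h : SystemsTransfer R n₁ n₂)
    {J K Q : Type*} [Fintype J] [Fintype K] [Fintype Q] (x : J → ι) (S : Q → J → R) (U : Q → K → R)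
    (h₁ : ∃ z : K → N₁, ∀ i, ∑ j, S i j • n₁ (x j) + ∑ k, U i k • z k = 0) :
    ∃ z : K → N₂, ∀ i, ∑ j, S i j • n₂ (x j) + ∑ k, U i k • z k = 0 := by
  let eJ := Fintype.equivFin J
  let eK := Fintype.equivFin K
  let eQ := Fintype.equivFin Q
  obtain ⟨z, hz⟩ := h₁
  obtain ⟨z', hz'⟩ := h _ _ _ (fun j => x (eJ.symm j)) (fun i j => S (eQ.symm i) (eJ.symm j))
    (fun i k => U (eQ.symm i) (eK.symm k)) ⟨fun k => z (eK.symm k), fun i => by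
      rw [eJ.symm.sum_comp fun j => S (eQ.symm i) j • n₁ (x j),
        eK.symm.sum_comp fun k => U (eQ.symm i) k • z k]
      exact hz _⟩
  refine ⟨fun k => z' (eK k), fun i => ?_⟩
  have := hz' (eQ i)
  rw [← eJ.sum_comp, ← eK.sum_comp] at this
  simpa using this

theorem sum_coe_smul_eq_linearCombination {κ : ι →₀ R} {X : Finset ι} (h : κ.support ⊆ X)
    (z : ι → N₁) : ∑ k : X, κ k • z k = Finsupp.linearCombination R z κ := by
  rw [Finsupp.linearCombination_apply, Finsupp.sum_of_support_subset κ h _ (by simp),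
    ← Finset.sum_coe_sort X]

/-- The finitely many relations in `N₁` that force the sum to vanish form a solvable system in the
given parameters. A solution of it in `N₂` forces the corresponding sum to vanish there. -/
theorem SystemsTransfer.tensorSum_eq_zero {n₁ : ι → N₁} {n₂ : ι → N₂}
    (h : SystemsTransfer R n₁ n₂) {L : Type*} [AddCommGroup L] [Module Rᵐᵒᵖ L] {f : ι →₀ L}
    (hf : tensorSum R L n₁ f = 0) : tensorSum R L n₂ f = 0 := by
  classical
  obtain ⟨T, hT, hT'⟩ := exists_finset_relations_of_tensorSum_eq_zero (R := R) (L := L) N₂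
    (f := f.mapDomain n₁) ((tensorSum_mapDomain _ _ _).trans hf)
  let X : Finset N₁ := T.biUnion Finsupp.support ∪ f.support.image n₁
  have hX : ∀ x ∈ f.support, n₁ x ∈ X := fun x hx =>
    Finset.mem_union_right _ (Finset.mem_image_of_mem _ hx)
  have hTX : ∀ κ ∈ T, κ.support ⊆ X := fun κ hκ =>
    (Finset.subset_biUnion_of_mem _ hκ).trans Finset.subset_union_left
  -- There is one unknown for each element of `X`, solved in `N₁` by that element itself. The first
  -- kind of equation ties the unknown at `n₁ j` to the parameter `n₁ j`; the second states the
  -- relations in `T`.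
  obtain ⟨z, hz⟩ := h.of_fintype (J := f.support) (K := X) (Q := f.support ⊕ T)
    (fun j => j) (Sum.elim (fun j j' => if j' = j then 1 else 0) fun _ _ => 0)
    (Sum.elim (fun j k => if k = ⟨n₁ j, hX j j.2⟩ then -1 else 0) fun κ k => κ.1 k)
    ⟨fun k => k, by
      rintro (j | κ)
      · simp [ite_smul]
      · simpa [hT κ κ.2] using sum_coe_smul_eq_linearCombination (hTX κ κ.2) (id : N₁ → N₁)⟩
  -- The value `0` off `X` is harmless: all the relations and the sum involve only elements of `X`.
  let z' : N₁ → N₂ := fun y => if hy : y ∈ X then z ⟨y, hy⟩ else 0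
  have hzz : ∀ k : X, z k = z' k := fun k => by simp [z']
  rw [← hT' z' fun κ hκ => ?_, tensorSum_mapDomain]
  · refine tensorSum_congr fun x hx => ?_
    have := hz (.inl ⟨x, hx⟩)
    simp only [Sum.elim_inl, ite_smul, one_smul, zero_smul, Finset.sum_ite_eq', Finset.mem_univ,
      if_true, neg_smul] at this
    rw [add_neg_eq_zero] at this
    rw [this, hzz]
    rfl
  · have := hz (.inr ⟨κ, hκ⟩)
    simp only [Sum.elim_inr, zero_smul, Finset.sum_const_zero, zero_add, hzz] at this
    rw [← sum_coe_smul_eq_linearCombination (hTX κ hκ), this]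

/-- A family in `N₁` can be mapped to a family in a character module if finite linear systems
transfer. -/
theorem SystemsTransfer.exists_linearMap {n₁ : ι → N₁} {n₂ : ι → N₂} (h : SystemsTransfer R n₁ n₂)
    {D : Type*} [AddCommGroup D] [Module Rᵐᵒᵖ D] (g : N₂ →ₗ[R] LeftDual D) :
    ∃ f : N₁ →ₗ[R] LeftDual D, ∀ x, f (n₁ x) = g (n₂ x) := by
  obtain ⟨c, hc⟩ := AddCircle.exists_extension_of_ker_le (tensorSum R D n₁)
    ((LeftDual.toCharacter g).comp (tensorSum R D n₂)) fun t ht => by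
      rw [AddMonoidHom.mem_ker] at ht ⊢
      rw [AddMonoidHom.comp_apply, h.tensorSum_eq_zero ht, map_zero]
  refine ⟨LeftDual.ofCharacter c, fun x => LeftDual.ext fun d => ?_⟩
  have := hc (Finsupp.single x d)
  rwa [tensorSum_single, AddMonoidHom.comp_apply, tensorSum_single] at this

end Transfer

/-- In a pure-injective module, the linear map given by a transfer of finite linear systems
exists. -/
theorem IsPureInjective.exists_linearMap {R : Type u} [Ring R] {ι : Type*}
    {N₁ N₂ E : Type (max u v)} [AddCommGroup N₁] [Module R N₁] [AddCommGroup N₂] [Module R N₂]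
    [AddCommGroup E] [Module R E] (hE : IsPureInjective R E) {n₁ : ι → N₁} {n₂ : ι → N₂}
    (h : SystemsTransfer R n₁ n₂) (g : N₂ →ₗ[R] E) :
    ∃ f : N₁ →ₗ[R] E, ∀ x, f (n₁ x) = g (n₂ x) := by
  -- Pure-injectivity splits the pure embedding of `E` into its double dual.
  obtain ⟨r, hr⟩ := hE _ _ (doubleDualEval R E) .id (doubleDualEval_isPureEmbedding E)
  obtain ⟨f, hf⟩ := h.exists_linearMap (doubleDualEval R E ∘ₗ g)
  exact ⟨r ∘ₗ f, fun x => (congrArg r (hf x)).trans (LinearMap.congr_fun hr _)⟩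

/-- Pure embeddings reflect the solvability of finite linear systems. -/
theorem IsPureEmbedding.exists_solution {R : Type u} [Ring R] {N N' : Type (max u v)}
    [AddCommGroup N] [Module R N] [AddCommGroup N'] [Module R N'] {f : N →ₗ[R] N'}
    (hf : IsPureEmbedding f) {K Q : Type*} [Fintype K] [Fintype Q] (c : Q → N) (U : Q → K → R)
    (h : ∃ z : K → N', ∀ i, f (c i) + ∑ k, U i k • z k = 0) :
    ∃ z : K → N, ∀ i, c i + ∑ k, U i k • z k = 0 := by
  classical
  obtain ⟨z, hz⟩ := h
  -- `B` consists of the values of the matrix `U` on `N`. If `c` is not in `B`, a character kills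
  -- `B` but not `c`.
  let B : AddSubgroup (Q → N) := AddMonoidHom.range
    { toFun := fun (y : K → N) i => ∑ k, U i k • y k
      map_zero' := by ext; simp
      map_add' := fun y y' => by ext; simp [Finset.sum_add_distrib] }
  suffices hc : c ∈ B by
    obtain ⟨y, hy⟩ := hc
    refine ⟨-y, fun i => ?_⟩
    rw [← show ∑ k, U i k • y k = c i from congrFun hy i]
    simp
  by_contra hc
  obtain ⟨χ, hχ⟩ := AddCircle.exists_addMonoidHom_apply_ne_zero
    (a := (QuotientAddGroup.mk c : (Q → N) ⧸ B)) (by rwa [Ne, QuotientAddGroup.eq_zero_iff])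
  let ψ : (Q → N) →+ AddCircle (1 : ℝ) := χ.comp (QuotientAddGroup.mk' B)
  have hψ : ∀ y : K → N, ψ (fun i => ∑ k, U i k • y k) = 0 := fun y => by
    have : (QuotientAddGroup.mk' B) (fun i => ∑ k, U i k • y k) = 0 :=
      (QuotientAddGroup.eq_zero_iff _).2 ⟨y, rfl⟩
    rw [AddMonoidHom.comp_apply, this, map_zero]
  -- The coordinates of `ψ` are elements of the right module `RightDual N`. Since `ψ` kills `B`,
  -- they satisfy `∑ i, d i * U i k = 0`, so the solution in `N'` makes `∑ d i ⊗ f (c i)` vanish; by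
  -- purity `∑ d i ⊗ c i = 0`, and evaluation gives `ψ c = 0`.
  let d : Q → RightDual N := fun i => (ψ.comp (AddMonoidHom.single (fun _ => N) i) :)
  have hd : ∀ (i : Q) (n : N), d i n = ψ (Pi.single i n) := fun _ _ => rfl
  have hsum : ∀ y : Q → N, ∑ i, d i (y i) = ψ y := fun y => by
    simp_rw [hd]
    rw [← map_sum, Finset.univ_sum_single]
  have happly : ∀ (y : Q → RightDual N) (n : N), (∑ i, y i) n = ∑ i, y i n := fun y n =>
    map_sum (AddMonoidHom.mk' (fun e : RightDual N => e n) fun _ _ => rfl) y _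
  have hdU : ∀ k, ∑ i, MulOpposite.op (U i k) • d i = 0 := fun k => RightDual.ext fun n => by
    rw [happly]
    simp only [RightDual.smul_apply, MulOpposite.unop_op, RightDual.zero_apply]
    rw [hsum fun i => U i k • n]
    simpa [Pi.single_apply] using hψ (Pi.single k n)
  have ht : ∑ i, tmul R (d i) (c i) = 0 := by
    apply hf.tensor_injective (RightDual N)
    rw [map_zero, map_sum]
    have : ∀ i, map .id f (tmul R (d i) (c i)) =
        -∑ k, tmul R (MulOpposite.op (U i k) • d i) (z k) := fun i => by
      rw [map_tmul, eq_neg_of_add_eq_zero_left (hz i)]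
      simp [op_smul_tmul]
    simp_rw [this]
    rw [Finset.sum_neg_distrib, Finset.sum_comm, neg_eq_zero]
    refine Finset.sum_eq_zero fun k _ => ?_
    rw [← AddMonoidHom.finsetSum_apply, ← map_sum, hdU, map_zero, AddMonoidHom.zero_apply]
  have := congrArg (LeftDual.toCharacter (doubleDualEval R N)) ht
  rw [map_zero, map_sum] at this
  exact hχ ((hsum c).symm.trans this)

/-! ### pp-types under pure embeddings, and the systems they transfer. -/

section PPTypes

variable {R : Type u} [Ring R]

theorem IsPureEmbedding.realize_iff {B N N' : Type (max u v)} [AddCommGroup N]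
    [Module R N] [AddCommGroup N'] [Module R N'] {f : N →ₗ[R] N'} (hf : IsPureEmbedding f)
    (φ : PPFormula R B) (incl : B → N) (x : Fin φ.arity → N) :
    φ.Realize (f ∘ incl) (f ∘ x) ↔ φ.Realize incl x := by
  constructor
  · rintro ⟨z, hz⟩
    obtain ⟨y, hy⟩ := hf.exists_solution
      (fun i => ∑ j, φ.coeffFree i j • x j + ∑ l, φ.coeffParam i l • incl (φ.param l))
      φ.coeffBound ⟨z, fun i => by
        have := hz i
        rw [add_right_comm] at this
        simpa using this⟩
    exact ⟨y, fun i => by rw [add_right_comm]; exact hy i⟩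
  · rintro ⟨z, hz⟩
    exact ⟨f ∘ z, fun i => by simpa using congrArg f (hz i)⟩

theorem IsPureEmbedding.ppType_map {B N N' : Type (max u v)} [AddCommGroup N]
    [Module R N] [AddCommGroup N'] [Module R N'] {f : N →ₗ[R] N'} (hf : IsPureEmbedding f)
    (incl : B → N) (b : List N) : ppType R (f ∘ incl) (b.map f) = ppType R incl b := by
  ext φ
  have hmap : ∀ (h : φ.arity = b.length) (h' : φ.arity = (b.map f).length),
      (fun j => (b.map f).get (Fin.cast h' j)) = f ∘ fun j => b.get (Fin.cast h j) := by
    intro h h'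
    ext j
    simp
  constructor
  · rintro ⟨h', hφ⟩
    have h : φ.arity = b.length := h'.trans (List.length_map _)
    rw [hmap h h', hf.realize_iff] at hφ
    exact ⟨h, hφ⟩
  · rintro ⟨h, hφ⟩
    have h' : φ.arity = (b.map f).length := h.trans (List.length_map _).symm
    refine ⟨h', ?_⟩
    rw [hmap h h', hf.realize_iff]
    exact hφ

theorem FlatTriple.AtEquiv.ppType_eq {A : Type (max u v)} {T₁ T₂ : FlatTriple R A}
    (h : T₁.AtEquiv T₂) : ppType R T₁.incl T₁.tuple = ppType R T₂.incl T₂.tuple := by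
  obtain ⟨N, _, _, f₁, f₂, -, h₁, h₂, hA, hb⟩ := h
  rw [← h₁.ppType_map, ← h₂.ppType_map, hb, show f₁ ∘ T₁.incl = f₂ ∘ T₂.incl from funext hA]

/-- Galois-types determine pp-types. -/
theorem FlatTriple.ppType_eq_of_transGen {A : Type (max u v)} {T₁ T₂ : FlatTriple R A}
    (h : Relation.TransGen FlatTriple.AtEquiv T₁ T₂) :
    ppType R T₁.incl T₁.tuple = ppType R T₂.incl T₂.tuple := by
  induction h with
  | single h => exact h.ppType_eq
  | tail _ h ih => exact ih.trans h.ppType_eq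

/-- The empty system holds of every tuple, so as a formula it records only the number of free
variables. -/
theorem length_eq_of_ppType_eq {B N₁ N₂ : Type w} [AddCommGroup N₁] [Module R N₁]
    [AddCommGroup N₂] [Module R N₂] {i₁ : B → N₁} {i₂ : B → N₂} {b₁ : List N₁} {b₂ : List N₂}
    (h : ppType R i₁ b₁ = ppType R i₂ b₂) : b₁.length = b₂.length := by
  have : (⟨b₁.length, 0, 0, 0, nofun, nofun, nofun, nofun⟩ : PPFormula R B) ∈ ppType R i₁ b₁ :=
    ⟨rfl, nofun, nofun⟩
  rw [h] at this
  exact this.1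

/-- A pp-type transfers finite linear systems with parameters among the parameters of the type and
the entries of the tuple. -/
theorem systemsTransfer_of_ppType_subset {B N₁ N₂ : Type w} [Zero B] [AddCommGroup N₁]
    [Module R N₁] [AddCommGroup N₂] [Module R N₂] {i₁ : B → N₁} {i₂ : B → N₂} {b₁ : List N₁}
    {b₂ : List N₂} (hlen : b₁.length = b₂.length) (h : ppType R i₁ b₁ ⊆ ppType R i₂ b₂) :
    SystemsTransfer R (Sum.elim i₁ b₁.get) (Sum.elim i₂ fun j => b₂.get (Fin.cast hlen j)) := by
  classical
  intro s p q x S U hz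
  -- A tuple entry may occur at several positions of `x`, so its coefficients are added up.
  -- Positions naming a tuple entry receive the dummy parameter `0` with coefficient zero, so its
  -- interpretation does not matter.
  let φ : PPFormula R B :=
    { arity := b₁.length
      numBound := p
      numParam := s
      numEq := q
      coeffFree := fun i j => ∑ l, if x l = .inr j then S i l else 0
      coeffBound := U
      coeffParam := fun i l => if (x l).isLeft then S i l else 0
      param := fun l => Sum.elim id (fun _ => 0) (x l) }
  have hsum : ∀ {N : Type w} [AddCommGroup N] [Module R N] (i : B → N) (b : Fin b₁.length → N)
      (e : Fin q), ∑ j, φ.coeffFree e j • b j + ∑ l, φ.coeffParam e l • i (φ.param l) =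
        ∑ l, S e l • Sum.elim i b (x l) := by
    intro N _ _ i b e
    simp only [φ, Finset.sum_smul]
    rw [Finset.sum_comm, ← Finset.sum_add_distrib]
    refine Finset.sum_congr rfl fun l _ => ?_
    cases x l <;> simp [ite_smul]
  have hiff : ∀ {N : Type w} [AddCommGroup N] [Module R N] (i : B → N) (b : Fin b₁.length → N),
      φ.Realize i b ↔
        ∃ z : Fin p → N, ∀ e, ∑ l, S e l • Sum.elim i b (x l) + ∑ k, U e k • z k = 0 := by
    intro N _ _ i b
    refine exists_congr fun z => forall_congr' fun e => ?_
    rw [← hsum, add_right_comm]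
  obtain ⟨_, hφ⟩ := h (show φ ∈ ppType R i₁ b₁ from ⟨rfl, (hiff i₁ b₁.get).2 hz⟩)
  exact (hiff i₂ _).1 hφ

end PPTypes

/-! ### Galois-types versus pp-types, and tameness. -/

section Main

variable {R : Type u} [Ring R]

/-- The pure-injective envelope of every flat module is flat. -/
def FlatEnvelopes (R : Type u) [Ring R] : Prop :=
  ∀ (F E : Type (max u v)) [AddCommGroup F] [Module R F] [AddCommGroup E] [Module R E]
    (i : F →ₗ[R] E), IsFlatModule R F → IsPureInjectiveEnvelope i → IsFlatModule R E

theorem FlatTriple.atEquiv_of_ppType_eq (hR : FlatEnvelopes.{u, v} R) {B : Type (max u v)}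
    [Zero B] {T₁ T₂ : FlatTriple R B}
    (h : ppType R T₁.incl T₁.tuple = ppType R T₂.incl T₂.tuple) : T₁.AtEquiv T₂ := by
  obtain ⟨E₁, _, _, j₁, hj₁⟩ := exists_isPureInjectiveEnvelope.{u, v} (R := R) T₁.model
  obtain ⟨E₂, _, _, j₂, hj₂⟩ := exists_isPureInjectiveEnvelope.{u, v} (R := R) T₂.model
  have hlen := length_eq_of_ppType_eq h
  obtain ⟨g, hg⟩ := hj₂.pureInjective.exists_linearMap
    (systemsTransfer_of_ppType_subset hlen h.subset) j₂
  obtain ⟨k, hk⟩ := hj₁.pureInjective.exists_linearMap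
    (systemsTransfer_of_ppType_subset hlen.symm h.symm.subset) j₁
  -- Each map into the product is pure because its composite with one projection is an envelope
  -- embedding; the other coordinate serves only to make the two maps agree.
  refine ⟨E₁ × E₂, inferInstance, inferInstance, j₁.prod g, k.prod j₂,
    (hR _ _ j₁ T₁.flat hj₁).prod (hR _ _ j₂ T₂.flat hj₂),
    IsPureEmbedding.of_comp (g := .fst R E₁ E₂) hj₁.pureEmbedding,
    IsPureEmbedding.of_comp (g := .snd R E₁ E₂) hj₂.pureEmbedding,
    fun a => Prod.ext (hk (.inl a)).symm (hg (.inl a)), ?_⟩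
  refine List.ext_get (by simpa using hlen) fun n hn₁ hn₂ => ?_
  rw [List.length_map] at hn₁ hn₂
  have h₁ := hg (.inr ⟨n, hn₁⟩)
  have h₂ := hk (.inr ⟨n, hn₂⟩)
  simp only [Sum.elim_inr, List.get_eq_getElem, Fin.cast_mk] at h₁ h₂
  simp [h₁, h₂]

theorem gtp_eq_iff_ppType_eq (hR : FlatEnvelopes.{u, v} R) {B N₁ N₂ : Type (max u v)} [Zero B]
    [AddCommGroup N₁] [Module R N₁] [AddCommGroup N₂] [Module R N₂] (hN₁ : IsFlatModule R N₁)
    (hN₂ : IsFlatModule R N₂) (i₁ : B ↪ N₁) (i₂ : B ↪ N₂) (b₁ : List N₁) (b₂ : List N₂) :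
    gtp hN₁ i₁ b₁ = gtp hN₂ i₂ b₂ ↔ ppType R i₁ b₁ = ppType R i₂ b₂ := by
  constructor
  · exact fun h => FlatTriple.ppType_eq_of_transGen (Quotient.exact h)
  · exact fun h => Quotient.sound (.single (FlatTriple.atEquiv_of_ppType_eq hR h))

/-- The pp-type over a set is determined by the pp-types over its finite subsets. -/
theorem ppType_subset_of_finite {B N₁ N₂ : Type w} [AddCommGroup N₁] [Module R N₁]
    [AddCommGroup N₂] [Module R N₂] {i₁ : B → N₁} {i₂ : B → N₂} {b₁ : List N₁} {b₂ : List N₂}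
    (h : ∀ C : Set B, C.Finite →
      ppType R (fun c : C => i₁ c) b₁ = ppType R (fun c : C => i₂ c) b₂) :
    ppType R i₁ b₁ ⊆ ppType R i₂ b₂ := by
  intro φ hφ
  let ψ : PPFormula R (Set.range φ.param) :=
    { φ with param := fun l => ⟨φ.param l, Set.mem_range_self l⟩ }
  have hψ : ψ ∈ ppType R (fun c : Set.range φ.param => i₁ c) b₁ := hφ
  rw [h _ (Set.finite_range _)] at hψ
  exact hψ

/-- If the restrictions to all finite sets agree, so do the pp-types over finite sets, hence the
pp-types over `M`, hence the Galois-types. Flat envelopes enter only in the last step. -/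
theorem flatModulesTameFinite (hR : FlatEnvelopes.{u, v} R) :
    FlatModulesTameFinite.{u, max u v} R ℵ₀ := by
  rintro M _ _ - _ ⟨N₁, _, _, hN₁, i₁, hi₁, b₁, rfl⟩ _ ⟨N₂, _, _, hN₂, i₂, hi₂, b₂, rfl⟩ hne
  by_contra! hC
  have key : ∀ C : Set M, C.Finite →
      ppType R (fun c : C => i₁ c) b₁ = ppType R (fun c : C => i₂ c) b₂ := fun C hfin =>
    FlatTriple.ppType_eq_of_transGen (Quotient.exact (hC C (Cardinal.lt_aleph0_iff_finite.2 hfin)))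
  exact hne ((gtp_eq_iff_ppType_eq hR _ _ _ _ _ _).2 ((ppType_subset_of_finite key).antisymm
    (ppType_subset_of_finite fun C hfin => (key C hfin).symm)))

theorem FlatModulesTameFinite.flatModulesTame {κ : Cardinal.{w}}
    (h : FlatModulesTameFinite.{u, w} R κ) : FlatModulesTame.{u, w} R κ := by
  rintro M _ _ hM _ ⟨N₁, _, _, hN₁, i₁, hi₁, b₁, rfl⟩ _ ⟨N₂, _, _, hN₂, i₂, hi₂, b₂, rfl⟩ hne
  exact h M hM _ ⟨N₁, _, _, hN₁, i₁, hi₁, [b₁], rfl⟩ _ ⟨N₂, _, _, hN₂, i₂, hi₂, [b₂], rfl⟩ hne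

end Main

theorem lemma4p4 {R : Type u} [Ring R]
    (hR : ∀ (F E : Type (max u v)) [AddCommGroup F] [Module R F] [AddCommGroup E] [Module R E]
      (i : F →ₗ[R] E), IsFlatModule R F → IsPureInjectiveEnvelope i → IsFlatModule R E) :
    (∀ (M N₁ N₂ : Type (max u v)) [AddCommGroup M] [Module R M] [AddCommGroup N₁] [Module R N₁]
      [AddCommGroup N₂] [Module R N₂] (_ : IsFlatModule R M) (hN₁ : IsFlatModule R N₁)
      (hN₂ : IsFlatModule R N₂) (i₁ : M →ₗ[R] N₁) (i₂ : M →ₗ[R] N₂)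
      (hi₁ : IsPureEmbedding i₁) (hi₂ : IsPureEmbedding i₂) (b₁ : List N₁) (b₂ : List N₂),
      gtp hN₁ ⟨i₁, hi₁.injective⟩ b₁ = gtp hN₂ ⟨i₂, hi₂.injective⟩ b₂ ↔
        ppType R i₁ b₁ = ppType R i₂ b₂) ∧
    FlatModulesTame.{u, max u v} R ℵ₀ ∧ FlatModulesTameFinite.{u, max u v} R ℵ₀ := by
  refine ⟨?_, (flatModulesTameFinite hR).flatModulesTame, flatModulesTameFinite hR⟩
  intro M N₁ N₂ _ _ _ _ _ _ _ hN₁ hN₂ i₁ i₂ hi₁ hi₂ b₁ b₂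
  exact gtp_eq_iff_ppType_eq hR hN₁ hN₂ ⟨i₁, hi₁.injective⟩ ⟨i₂, hi₂.injective⟩ b₁ b₂
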